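/- Let $A\in\mathbb{R}^{n\times n}$, $B\in\mathbb{R}^{n\times p}$, let $C\in\mathbb{R}^{n\times n}$ be symmetric, and define $C_0=C$, $C_{i+1}=C_iA+A^\top C_i$. Suppose that $C_m=0$ for some integer $m\ge 1$. For an input $u:[0,\infty)\to\mathbb{R}^p$, consider the augmented linear time-varying system $\dot z=\mathcal{A}(u(t))z+\mathcal{B}u(t)$, $y=\mathcal{C}z$, with state $z=(z_0,\dots,z_{m-1},x)\in\mathbb{R}^{m+n}$ and $$\mathcal{A}(u)=\begin{bmatrix}S_m&U\\0&A\end{bmatrix},\qquad U=\begin{bmatrix}u^\top B^\top C_0\\\vdots\\u^\top B^\top C_{m-1}\end{bmatrix},\qquad \mathcal{B}=\begin{bmatrix}0\\B\end{bmatrix},\qquad \mathcal{C}=\begin{bmatrix}1&0&\cdots&0\end{bmatrix},$$ where $S_m\in\mathbb{R}^{m\times m}$ has ones on the superdiagonal and zeros elsewhere. Define row vectors $r_i(t)\in\mathbb{R}^{1\times n}$ by $r_0=0$ and $$r_{i+1}(t)=r_i(t)A+\dot r_i(t)+u^\top(t)B^\top C_i .$$ Assume that there is an integer $\kappa\ge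 m$ such that $u$ is $\kappa$ times differentiable on $[0,\infty)$ and $u,\dot u,\dots,u^{(\kappa)}$ are bounded on $[0,\infty)$, and that there are constants $\delta,\mu>0$ such that for all $t\ge0$ $$\int_t^{t+\delta}\det\Big(\sum_{i=m}^{\kappa}r_i^\top(s)r_i(s)\Big)\,ds\ge\mu .$$ Then the augmented system is uniformly observable: there exist $\bar\delta,\bar\mu>0$ such that for all $t\ge0$ $$\int_t^{t+\bar\delta}\Phi^\top(s,t)\,\mathcal{C}^\top\mathcal{C}\,\Phi(s,t)\,ds\ \ge\ \bar\mu\, I_{m+n}$$ in the order of symmetric matrices, where $\Phi$ is the state-transition matrix, $\frac{\partial}{\partial s}\Phi(s,t)=\mathcal{A}(u(s))\Phi(s,t)$, $\Phi(t,t)=I_{m+n}$. -/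

import Mathlib

open scoped Matrix

noncomputable section

namespace LTV

/-- `Φ t τ` is the state-transition matrix, on the time domain `[0, ∞)`, of the linear
time-varying system `ẋ = F(t) x`: `d/dt Φ(t, τ) = F(t) Φ(t, τ)` and `Φ(τ, τ) = I`
(the derivative is taken entrywise, and it is one-sided at `t = 0`). -/
def IsTransitionMatrix {ι : Type*} [Fintype ι] [DecidableEq ι]
    (F : ℝ → Matrix ι ι ℝ) (Φ : ℝ → ℝ → Matrix ι ι ℝ) : Prop :=
  ∀ τ : ℝ, 0 ≤ τ →
    Φ τ τ = 1 ∧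
    ∀ t : ℝ, 0 ≤ t → ∀ i j : ι,
      HasDerivWithinAt (fun s => Φ s τ i j) ((F t * Φ t τ) i j) (Set.Ici 0) t

/-- The observability Gramian
`W(t₀, T) = ∫_{t₀}^{T} Φ(s, t₀)ᵀ H(s)ᵀ H(s) Φ(s, t₀) ds`, integrated entrywise. -/
def gramian {ι o : Type*} [Fintype ι] [Fintype o]
    (Φ : ℝ → ℝ → Matrix ι ι ℝ) (H : ℝ → Matrix o ι ℝ) (t₀ T : ℝ) : Matrix ι ι ℝ :=
  Matrix.of fun i j =>
    ∫ s in t₀..T, ((Φ s t₀)ᵀ * (H s)ᵀ * H s * Φ s t₀) i j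

/-- The pair `(F(t), H(t))` is uniformly observable: for its transition matrix, there are
`δ, μ > 0` such that `W(t, t + δ) ≥ μ I` (in the Loewner order) for every `t ≥ 0`. -/
def UniformlyObservable {ι o : Type*} [Fintype ι] [DecidableEq ι] [Fintype o]
    (F : ℝ → Matrix ι ι ℝ) (H : ℝ → Matrix o ι ℝ) : Prop :=
  ∃ Φ : ℝ → ℝ → Matrix ι ι ℝ, IsTransitionMatrix F Φ ∧
    ∃ δ : ℝ, 0 < δ ∧ ∃ μ : ℝ, 0 < μ ∧
      ∀ t : ℝ, 0 ≤ t →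
        (gramian Φ H t (t + δ) - μ • (1 : Matrix ι ι ℝ)).PosSemidef

end LTV

namespace QuadraticOutput

/-- The matrices `C₀ = C`, `C_{i+1} = C_i A + Aᵀ C_i`. -/
def Cmat {n : ℕ} (A C : Matrix (Fin n) (Fin n) ℝ) : ℕ → Matrix (Fin n) (Fin n) ℝ
  | 0 => C
  | i + 1 => Cmat A C i * A + Aᵀ * Cmat A C i

/-- The `m × m` shift matrix: ones on the superdiagonal, zeros elsewhere. -/
def shift (m : ℕ) : Matrix (Fin m) (Fin m) ℝ :=
  Matrix.of fun i j => if (j : ℕ) = (i : ℕ) + 1 then 1 else 0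

/-- The `m × n` matrix `U(t)` whose rows are `u(t)ᵀ Bᵀ C_i`, `i = 0, …, m - 1`. -/
def inputBlock {n p : ℕ} (A C : Matrix (Fin n) (Fin n) ℝ) (B : Matrix (Fin n) (Fin p) ℝ)
    (m : ℕ) (u : ℝ → Fin p → ℝ) (t : ℝ) : Matrix (Fin m) (Fin n) ℝ :=
  Matrix.of fun i => u t ᵥ* (Bᵀ * Cmat A C (i : ℕ))

/-- The state matrix `𝒜(u(t))` of the augmented system, whose state is
`(z₀, …, z_{m-1}, x)`. -/
def augA {n p : ℕ} (A C : Matrix (Fin n) (Fin n) ℝ) (B : Matrix (Fin n) (Fin p) ℝ)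
    (m : ℕ) (u : ℝ → Fin p → ℝ) (t : ℝ) : Matrix (Fin m ⊕ Fin n) (Fin m ⊕ Fin n) ℝ :=
  Matrix.fromBlocks (shift m) (inputBlock A C B m u t) 0 A

/-- The output matrix `𝒞 = (1, 0, …, 0 | 0)` of the augmented system: it reads off `z₀`. -/
def augC (m n : ℕ) : Matrix (Fin 1) (Fin m ⊕ Fin n) ℝ :=
  Matrix.of fun _ => Sum.elim (fun i : Fin m => if (i : ℕ) = 0 then 1 else 0) (fun _ => 0)

/-- The row vectors `r₀ = 0`, `r_{i+1} = r_i A + ṙ_i + uᵀ Bᵀ C_i` on the time domain `[0, ∞)`. -/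
def r {n p : ℕ} (A C : Matrix (Fin n) (Fin n) ℝ) (B : Matrix (Fin n) (Fin p) ℝ)
    (u : ℝ → Fin p → ℝ) : ℕ → ℝ → Fin n → ℝ
  | 0 => fun _ => 0
  | i + 1 => fun t =>
      r A C B u i t ᵥ* A + derivWithin (r A C B u i) (Set.Ici 0) t
        + u t ᵥ* (Bᵀ * Cmat A C i)

/-- On `[0, ∞)`, the input `u` is `κ` times differentiable, and `u` and its derivatives up to
order `κ` are bounded (continuity of the `κ`-th derivative is not required). -/
def BoundedDerivs {p : ℕ} (κ : ℕ) (u : ℝ → Fin p → ℝ) : Prop :=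
  (∀ i < κ, DifferentiableOn ℝ (iteratedDerivWithin i u (Set.Ici 0)) (Set.Ici 0)) ∧
  (∀ i ≤ κ, ∃ M : ℝ, ∀ t : ℝ, 0 ≤ t → ‖iteratedDerivWithin i u (Set.Ici 0) t‖ ≤ M)

end QuadraticOutput

end

open scoped Matrix

/-! Along a solution `(z, x)` the `i`-th derivative of the output `z₀` is `z_i + r_i x`, with `z_i =
0` for `i ≥ m` because `C_i = 0` there (`hasDerivWithinAt_outputDeriv`). If the Gramian over `[t, t
+ δ]` is small on a unit initial state, the output is small in `L²`. Its derivatives up to order `κ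
+ 1` are bounded, so interpolation makes those up to order `κ` uniformly small
(`exists_abs_le_of_integral_sq_le_of_hasDerivWithinAt`). Excitation gives a time in the window where
the determinant is at least `μ / (2δ)` in absolute value. There the orders `m..κ` force `x` to be
small, and then the lower orders force `z` to be small (`exists_norm_le_of_abs_outputDeriv_le`).
Gronwall run backwards to `t` contradicts the unit norm. No constant depends on `t`. -/

/-! ### Interpolation between a function and its derivatives -/

/-- Landau's argument: over a step of length `h`, `f'` varies by at most `M h ≤ ε / 2`, so a large
`f' s` would move `f` by more than `2η`. Only the mean value inequality is used, so `f''` need not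
be continuous. -/
theorem exists_abs_deriv_le_of_abs_le {δ M ε : ℝ} (hδ : 0 < δ) (hM : 0 ≤ M) (hε : 0 < ε) :
    ∃ η > 0, ∀ (a : ℝ) (f f' f'' : ℝ → ℝ),
      (∀ s ∈ Set.Icc a (a + δ), HasDerivWithinAt f (f' s) (Set.Icc a (a + δ)) s) →
      (∀ s ∈ Set.Icc a (a + δ), HasDerivWithinAt f' (f'' s) (Set.Icc a (a + δ)) s) →
      (∀ s ∈ Set.Icc a (a + δ), |f'' s| ≤ M) →
      (∀ s ∈ Set.Icc a (a + δ), |f s| ≤ η) →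
      ∀ s ∈ Set.Icc a (a + δ), |f' s| ≤ ε := by
  -- `h ≤ δ / 2` lets every point step left or right inside the window; `M + 1` avoids dividing by
  -- zero.
  set h := min (δ / 2) (ε / (2 * (M + 1))) with hh
  have hpos : 0 < h := by positivity
  have hhδ : h ≤ δ / 2 := min_le_left _ _
  have hhε : M * h ≤ ε / 2 := by
    have : h * (2 * (M + 1)) ≤ ε := (le_div_iff₀ (by positivity)).1 (min_le_right _ _)
    nlinarith
  refine ⟨ε * h / 4, by positivity, fun a f f' f'' hf hf' hM'' hfη s hs => ?_⟩
  obtain ⟨s', hs', hdist⟩ : ∃ s' ∈ Set.Icc a (a + δ), |s' - s| = h := by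
    rcases le_total s (a + δ / 2) with hle | hle
    · exact ⟨s + h, ⟨by linarith [hs.1], by linarith⟩, by simp [abs_of_pos hpos]⟩
    · exact ⟨s - h, ⟨by linarith, by linarith [hs.2]⟩, by simp [abs_of_pos hpos]⟩
  have hsub : Set.uIcc s s' ⊆ Set.Icc a (a + δ) := Set.OrdConnected.uIcc_subset Set.ordConnected_Icc hs hs'
  have hlip : ∀ x ∈ Set.uIcc s s', |f' x - f' s| ≤ ε / 2 := by
    intro x hx
    have h1 := (convex_Icc a (a + δ)).norm_image_sub_le_of_norm_hasDerivWithin_le hf'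
      (fun x hx => hM'' x hx) hs (hsub hx)
    have h2 : |x - s| ≤ |s' - s| := Set.abs_sub_left_of_mem_uIcc hx
    simp only [Real.norm_eq_abs] at h1
    have := mul_le_mul_of_nonneg_left h2 hM
    rw [hdist] at this
    linarith
  have key := (convex_uIcc s s').norm_image_sub_le_of_norm_hasDerivWithin_le
    (f := fun x => f x - f' s * x) (f' := fun x => f' x - f' s) (C := ε / 2)
    (fun x hx => by
      simpa using ((hf x (hsub hx)).mono hsub).fun_sub ((hasDerivWithinAt_id x _).const_mul (f' s)))
    hlip Set.left_mem_uIcc Set.right_mem_uIcc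
  simp only [Real.norm_eq_abs, hdist] at key
  have h1 := hfη s hs
  have h2 := hfη s' hs'
  have h3 : |f' s| * h ≤ ε * h := by
    rw [← hdist, ← abs_mul, hdist]
    have : f' s * (s' - s) = f s' - f s - (f s' - f' s * s' - (f s - f' s * s)) := by ring
    rw [this]
    rw [abs_le] at *
    constructor <;> linarith [key.1, key.2, h1.1, h1.2, h2.1, h2.2]
  exact le_of_mul_le_mul_right h3 hpos

/-- Landau's argument for the primitive of `f ^ 2`: it is at most `η`, its derivative is `f ^ 2`,
and its second derivative `2 f f'` is bounded. -/
theorem exists_abs_le_of_integral_sq_le {δ M ε : ℝ} (hδ : 0 < δ) (hM : 0 ≤ M) (hε : 0 < ε) :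
    ∃ η > 0, ∀ (a : ℝ) (f f' : ℝ → ℝ),
      (∀ s ∈ Set.Icc a (a + δ), HasDerivWithinAt f (f' s) (Set.Icc a (a + δ)) s) →
      (∀ s ∈ Set.Icc a (a + δ), |f s| ≤ M) →
      (∀ s ∈ Set.Icc a (a + δ), |f' s| ≤ M) →
      ∫ s in a..(a + δ), f s ^ 2 ≤ η →
      ∀ s ∈ Set.Icc a (a + δ), |f s| ≤ ε := by
  obtain ⟨η, hη, H⟩ := exists_abs_deriv_le_of_abs_le (M := 2 * M * M) (ε := ε ^ 2) hδ
    (by positivity) (by positivity)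
  refine ⟨η, hη, fun a f f' hf hb hb' hint s hs => ?_⟩
  have hle : a ≤ a + δ := by linarith
  have hcont : ContinuousOn (fun s => f s ^ 2) (Set.Icc a (a + δ)) :=
    ContinuousOn.pow (fun x hx => (hf x hx).continuousWithinAt) 2
  have hii : ∀ x ∈ Set.Icc a (a + δ), ∀ y ∈ Set.Icc a (a + δ),
      IntervalIntegrable (fun s => f s ^ 2) MeasureTheory.volume x y := fun x hx y hy =>
    (hcont.mono (Set.OrdConnected.uIcc_subset Set.ordConnected_Icc hx hy)).intervalIntegrable
  have ha : a ∈ Set.Icc a (a + δ) := ⟨le_rfl, hle⟩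
  have hb0 : a + δ ∈ Set.Icc a (a + δ) := ⟨hle, le_rfl⟩
  have hsq := H a (fun x => ∫ s in a..x, f s ^ 2) (fun x => f x ^ 2) (fun x => 2 * f x * f' x)
    (fun x hx => by
      -- Supplies the `FTCFilter` instance for derivatives within the closed interval.
      have : Fact (x ∈ Set.Icc a (a + δ)) := ⟨hx⟩
      exact intervalIntegral.integral_hasDerivWithinAt_right (hii a ha x hx)
        (hcont.stronglyMeasurableAtFilter_nhdsWithin measurableSet_Icc x) (hcont x hx))
    (fun x hx => by simpa using (hf x hx).fun_pow 2)
    (fun x hx => by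
      rw [abs_mul, abs_mul, abs_two]
      have := hb x hx
      have := hb' x hx
      gcongr)
    (fun x hx => by
      have h1 : 0 ≤ ∫ s in a..x, f s ^ 2 :=
        intervalIntegral.integral_nonneg hx.1 fun _ _ => sq_nonneg _
      have h2 : 0 ≤ ∫ s in x..(a + δ), f s ^ 2 :=
        intervalIntegral.integral_nonneg hx.2 fun _ _ => sq_nonneg _
      have h3 := intervalIntegral.integral_add_adjacent_intervals (hii a ha x hx)
        (hii x hx _ hb0)
      rw [abs_of_nonneg h1]
      linarith) s hs
  rw [abs_of_nonneg (sq_nonneg _)] at hsq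
  exact abs_le_of_sq_le_sq hsq hε.le

theorem exists_abs_le_of_integral_sq_le_of_hasDerivWithinAt {δ M : ℝ} (hδ : 0 < δ) (hM : 0 ≤ M)
    (k : ℕ) : ∀ ε > 0, ∃ η > 0, ∀ (a : ℝ) (f : ℕ → ℝ → ℝ),
      (∀ i ≤ k, ∀ s ∈ Set.Icc a (a + δ),
        HasDerivWithinAt (f i) (f (i + 1) s) (Set.Icc a (a + δ)) s) →
      (∀ i ≤ k + 1, ∀ s ∈ Set.Icc a (a + δ), |f i s| ≤ M) →
      ∫ s in a..(a + δ), f 0 s ^ 2 ≤ η →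
      ∀ i ≤ k, ∀ s ∈ Set.Icc a (a + δ), |f i s| ≤ ε := by
  induction k with
  | zero =>
    intro ε hε
    obtain ⟨η, hη, H⟩ := exists_abs_le_of_integral_sq_le hδ hM hε
    refine ⟨η, hη, fun a f hf hb hint i hi => ?_⟩
    obtain rfl : i = 0 := by omega
    exact H a _ _ (hf 0 le_rfl) (hb 0 (by omega)) (hb 1 le_rfl) hint
  | succ k ih =>
    intro ε hε
    obtain ⟨η₁, hη₁, H₁⟩ := exists_abs_deriv_le_of_abs_le hδ hM hε
    obtain ⟨η, hη, H⟩ := ih (min ε η₁) (lt_min hε hη₁)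
    refine ⟨η, hη, fun a f hf hb hint i hi s hs => ?_⟩
    have h0 := H a f (fun i hi => hf i (by omega)) (fun i hi => hb i (by omega)) hint
    rcases Nat.lt_or_ge k i with hki | hki
    · obtain rfl : i = k + 1 := by omega
      exact H₁ a _ _ _ (hf k (by omega)) (hf (k + 1) le_rfl) (hb (k + 2) le_rfl)
        (fun s hs => (h0 k le_rfl s hs).trans (min_le_right _ _)) s hs
    · exact (h0 i hki s hs).trans (min_le_left _ _)

/-! ### Transition matrix and Gronwall estimates -/

theorem hasDerivAt_matrix_exp_smul_apply {ι : Type*} [Fintype ι] [DecidableEq ι]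
    (M : Matrix ι ι ℝ) (t : ℝ) (i j : ι) :
    HasDerivAt (fun s : ℝ => NormedSpace.exp (s • M) i j) ((M * NormedSpace.exp (t • M)) i j) t := by
  open scoped Matrix.Norms.Operator in
  have h := hasDerivAt_exp_smul_const' M t
  have := ((LinearMap.toContinuousLinearMap (Matrix.entryLinearMap ℝ ℝ i j)).hasFDerivAt).comp_hasDerivAt t h
  exact this

theorem hasDerivAt_matrix_mul_apply {α β γ : Type*} [Fintype β]
    {P P' : ℝ → Matrix α β ℝ} {Q Q' : ℝ → Matrix β γ ℝ} {t : ℝ}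
    (hP : ∀ i j, HasDerivAt (fun s => P s i j) (P' t i j) t)
    (hQ : ∀ i j, HasDerivAt (fun s => Q s i j) (Q' t i j) t) (i : α) (k : γ) :
    HasDerivAt (fun s => (P s * Q s) i k) ((P' t * Q t + P t * Q' t) i k) t := by
  simp only [Matrix.mul_apply, Matrix.add_apply, ← Finset.sum_add_distrib]
  exact HasDerivAt.fun_sum fun j _ => (hP i j).fun_mul (hQ j k)

/-- Variation of constants: the off-diagonal block is `e^{tS} ∫_τ^t e^{-sS} U(s) e^{(s-τ)A} ds`. -/
theorem exists_isTransitionMatrix_fromBlocks {α β : Type*} [Fintype α] [DecidableEq α]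
    [Fintype β] [DecidableEq β] (S : Matrix α α ℝ) (A : Matrix β β ℝ) (U : ℝ → Matrix α β ℝ)
    (hU : ∀ i j, ContinuousOn (fun t => U t i j) (Set.Ici 0)) :
    ∃ Φ, LTV.IsTransitionMatrix (fun t => Matrix.fromBlocks S (U t) 0 A) Φ := by
  have hcS : ∀ i j, Continuous fun s : ℝ => NormedSpace.exp (s • S) i j := fun i j =>
    continuous_iff_continuousAt.2 fun t => (hasDerivAt_matrix_exp_smul_apply S t i j).continuousAt
  have hcA : ∀ i j, Continuous fun s : ℝ => NormedSpace.exp (s • A) i j := fun i j =>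
    continuous_iff_continuousAt.2 fun t => (hasDerivAt_matrix_exp_smul_apply A t i j).continuousAt
  -- Extending `U` continuously to the whole line gives two-sided derivatives.
  have hcU : ∀ i j, Continuous fun s : ℝ => U (max s 0) i j := fun i j =>
    (hU i j).comp_continuous (by fun_prop) fun s => le_max_right s 0
  set K : ℝ → ℝ → Matrix α β ℝ := fun τ s =>
    NormedSpace.exp ((-s) • S) * U (max s 0) * NormedSpace.exp ((s - τ) • A) with hK
  have hcK : ∀ τ i j, Continuous fun s => K τ s i j := by
    intro τ i j
    simp only [hK, Matrix.mul_apply]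
    refine continuous_finsetSum _ fun b _ => Continuous.mul ?_ ((hcA b j).comp (by fun_prop))
    exact continuous_finsetSum _ fun a _ => ((hcS i a).comp (by fun_prop)).mul (hcU a b)
  set J : ℝ → ℝ → Matrix α β ℝ := fun t τ => Matrix.of fun i j => ∫ s in τ..t, K τ s i j with hJ
  have hJ' : ∀ τ t i j, HasDerivAt (fun s => J s τ i j) (K τ t i j) t := fun τ t i j =>
    intervalIntegral.integral_hasDerivAt_right ((hcK τ i j).intervalIntegrable _ _)
      ((hcK τ i j).stronglyMeasurableAtFilter _ _) (hcK τ i j).continuousAt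
  refine ⟨fun t τ => Matrix.fromBlocks (NormedSpace.exp ((t - τ) • S))
    (NormedSpace.exp (t • S) * J t τ) 0 (NormedSpace.exp ((t - τ) • A)), fun τ hτ => ⟨?_, ?_⟩⟩
  · have : J τ τ = 0 := by ext; simp [hJ]
    simp [this]
  · intro t ht
    have hmul : NormedSpace.exp (t • S) * K τ t = U t * NormedSpace.exp ((t - τ) • A) := by
      have h1 : NormedSpace.exp (t • S) * NormedSpace.exp ((-t) • S) = 1 := by
        rw [← Matrix.exp_add_of_commute]
        · simp
        · exact ((Commute.refl S).smul_left t).smul_right (-t)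
      simp only [hK, max_eq_left ht]
      rw [← Matrix.mul_assoc, ← Matrix.mul_assoc, h1, Matrix.one_mul]
    rw [Matrix.fromBlocks_multiply]
    rintro (i | i) (j | j) <;> apply HasDerivAt.hasDerivWithinAt
    · simpa using (hasDerivAt_matrix_exp_smul_apply S (t - τ) i j).comp_sub_const t τ
    · have := hasDerivAt_matrix_mul_apply (P' := fun t => S * NormedSpace.exp (t • S))
        (fun i j => hasDerivAt_matrix_exp_smul_apply S t i j) (hJ' τ t) i j
      rw [hmul] at this
      simpa [Matrix.mul_assoc] using this
    · simpa using hasDerivAt_const t (0 : ℝ)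
    · simpa using (hasDerivAt_matrix_exp_smul_apply A (t - τ) i j).comp_sub_const t τ

theorem norm_mulVec_le_of_abs_le {α β : Type*} [Fintype α] [Fintype β] {M : Matrix α β ℝ} {K : ℝ}
    (hK : 0 ≤ K) (hM : ∀ i j, |M i j| ≤ K) (v : β → ℝ) :
    ‖M *ᵥ v‖ ≤ Fintype.card β * K * ‖v‖ := by
  refine (pi_norm_le_iff_of_nonneg (by positivity)).2 fun i => ?_
  calc ‖∑ j, M i j * v j‖ ≤ ∑ j, ‖M i j * v j‖ := norm_sum_le _ _
    _ ≤ ∑ _j : β, K * ‖v‖ := Finset.sum_le_sum fun j _ => by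
      rw [norm_mul]
      exact mul_le_mul (hM i j) (norm_le_pi_norm v j) (norm_nonneg _) hK
    _ = _ := by simp [mul_assoc]

theorem norm_le_exp_mul_of_hasDerivWithinAt {E : Type*} [NormedAddCommGroup E] [NormedSpace ℝ E]
    {f f' : ℝ → E} {a b K : ℝ} (hf : ∀ s ∈ Set.Icc a b, HasDerivWithinAt f (f' s) (Set.Icc a b) s)
    (hK : ∀ s ∈ Set.Icc a b, ‖f' s‖ ≤ K * ‖f s‖) :
    ∀ s ∈ Set.Icc a b, ‖f s‖ ≤ ‖f a‖ * Real.exp (K * (s - a)) := by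
  intro s hs
  rw [← gronwallBound_ε0]
  refine norm_le_gronwallBound_of_norm_deriv_right_le
    (fun x hx => (hf x hx).continuousWithinAt) (fun x hx => ?_) le_rfl
    (fun x hx => by simpa using hK x (Set.Ico_subset_Icc_self hx)) s hs
  exact ((hf x (Set.Ico_subset_Icc_self hx)).mono (Set.Icc_subset_Icc_left hx.1)).mono_of_mem_nhdsWithin
    (Icc_mem_nhdsGE hx.2)

/-- Gronwall for the time reversal `s ↦ f (a + b - s)`. -/
theorem norm_left_le_exp_mul_of_hasDerivWithinAt {E : Type*} [NormedAddCommGroup E]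
    [NormedSpace ℝ E] {f f' : ℝ → E} {a b K : ℝ}
    (hf : ∀ s ∈ Set.Icc a b, HasDerivWithinAt f (f' s) (Set.Icc a b) s)
    (hK : ∀ s ∈ Set.Icc a b, ‖f' s‖ ≤ K * ‖f s‖) (hab : a ≤ b) :
    ‖f a‖ ≤ ‖f b‖ * Real.exp (K * (b - a)) := by
  have hmaps : Set.MapsTo (fun s => a + b - s) (Set.Icc a b) (Set.Icc a b) := fun s hs =>
    ⟨by linarith [hs.2], by linarith [hs.1]⟩
  have := norm_le_exp_mul_of_hasDerivWithinAt (f := fun s => f (a + b - s))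
    (f' := fun s => -f' (a + b - s)) (K := K) (a := a) (b := b)
    (fun s hs => by
      simpa [Function.comp_def] using HasDerivWithinAt.scomp s (hf _ (hmaps hs))
        ((hasDerivWithinAt_id s (Set.Icc a b)).const_sub (a + b)) hmaps)
    (fun s hs => by simpa using hK _ (hmaps hs)) b (Set.right_mem_Icc.2 hab)
  simpa using this

/-! ### Quantitative linear algebra -/

/-- Bounded matrices have bounded adjugates. -/
theorem exists_abs_adjugate_le (ι : Type*) [Fintype ι] [DecidableEq ι] (R : ℝ) :
    ∃ K : ℝ, 0 ≤ K ∧ ∀ M : Matrix ι ι ℝ, (∀ i j, |M i j| ≤ R) → ∀ i j, |M.adjugate i j| ≤ K := by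
  have hcpt : IsCompact (Set.univ.pi fun _ : ι => Set.univ.pi fun _ : ι => Set.Icc (-R) R) :=
    isCompact_univ_pi fun _ => isCompact_univ_pi fun _ => isCompact_Icc
  have hcont : Continuous fun M : Matrix ι ι ℝ => ∑ i, ∑ j, |M.adjugate i j| :=
    continuous_finsetSum _ fun i _ => continuous_finsetSum _ fun j _ =>
      ((continuous_id.matrix_adjugate).matrix_elem i j).abs
  obtain ⟨K, hK⟩ := hcpt.bddAbove_image hcont.continuousOn
  refine ⟨max K 0, le_max_right _ _, fun M hM i j => le_max_of_le_left ?_⟩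
  refine le_trans ?_ (hK ⟨M, fun i _ j _ => abs_le.1 (hM i j), rfl⟩)
  refine le_trans ?_ (Finset.single_le_sum (f := fun i => ∑ j, |M.adjugate i j|)
    (fun i _ => Finset.sum_nonneg fun j _ => abs_nonneg _) (Finset.mem_univ i))
  exact Finset.single_le_sum (f := fun j => |M.adjugate i j|) (fun j _ => abs_nonneg _)
    (Finset.mem_univ j)

namespace Matrix

theorem sum_vecMulVec_self_mulVec {ι σ : Type*} [Fintype ι] (s : Finset σ) (r : σ → ι → ℝ)
    (x : ι → ℝ) :
    (∑ i ∈ s, vecMulVec (r i) (r i)) *ᵥ x = ∑ i ∈ s, (r i ⬝ᵥ x) • r i := by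
  rw [sum_mulVec]
  exact Finset.sum_congr rfl fun i _ => by simp [vecMulVec_mulVec]

/-- From `adj(Q) Q = det(Q) I`: a lower bound on `Q` without inverting it. -/
theorem abs_det_mul_norm_le {ι : Type*} [Fintype ι] [DecidableEq ι] {Q : Matrix ι ι ℝ} {K : ℝ}
    (hK : 0 ≤ K) (hQ : ∀ i j, |Q.adjugate i j| ≤ K) (x : ι → ℝ) :
    |Q.det| * ‖x‖ ≤ Fintype.card ι * K * ‖Q *ᵥ x‖ := by
  have h := norm_mulVec_le_of_abs_le hK hQ (Q *ᵥ x)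
  rwa [mulVec_mulVec, adjugate_mul, smul_mulVec, one_mulVec, norm_smul, Real.norm_eq_abs] at h

theorem abs_dotProduct_le_card_mul {ι : Type*} [Fintype ι] (x y : ι → ℝ) :
    |x ⬝ᵥ y| ≤ Fintype.card ι * ‖x‖ * ‖y‖ := by
  calc |∑ j, x j * y j| ≤ ∑ j, |x j * y j| := Finset.abs_sum_le_sum_abs _ _
    _ ≤ ∑ _j : ι, ‖x‖ * ‖y‖ := Finset.sum_le_sum fun j _ => by
      rw [abs_mul]
      exact mul_le_mul (norm_le_pi_norm x j) (norm_le_pi_norm y j) (abs_nonneg _) (norm_nonneg _)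
    _ = _ := by simp [mul_assoc]

/-- The norm is the sup norm, so `v ⬝ᵥ v ≤ card ι * ‖v‖ ^ 2`; the `+ 1` covers empty `ι`. -/
theorem posSemidef_sub_smul_one_of_le {ι : Type*} [Fintype ι] [DecidableEq ι] {W : Matrix ι ι ℝ}
    (hW : W.IsSymm) {η : ℝ} (hη : 0 ≤ η) (h : ∀ v : ι → ℝ, ‖v‖ = 1 → η ≤ v ⬝ᵥ (W *ᵥ v)) :
    (W - (η / (Fintype.card ι + 1)) • (1 : Matrix ι ι ℝ)).PosSemidef := by
  refine PosSemidef.of_dotProduct_mulVec_nonneg ?_ fun v => ?_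
  · rw [IsHermitian, conjTranspose_eq_transpose_of_trivial]
    simp [hW.eq]
  · rw [sub_mulVec, smul_mulVec, one_mulVec, dotProduct_sub, dotProduct_smul, star_trivial,
      smul_eq_mul, sub_nonneg]
    rcases eq_or_ne v 0 with rfl | hv
    · simp
    have hv' : 0 < ‖v‖ := norm_pos_iff.2 hv
    have h1 := h (‖v‖⁻¹ • v) (by simp [norm_smul, hv'.ne'])
    rw [mulVec_smul, smul_dotProduct, dotProduct_smul, smul_eq_mul, smul_eq_mul] at h1
    have h2 : η * ‖v‖ ^ 2 ≤ v ⬝ᵥ (W *ᵥ v) := by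
      have := mul_le_mul_of_nonneg_right h1 (sq_nonneg ‖v‖)
      field_simp at this
      exact this
    have h3 : v ⬝ᵥ v ≤ (Fintype.card ι + 1) * ‖v‖ ^ 2 := by
      have := (le_abs_self _).trans (abs_dotProduct_le_card_mul v v)
      nlinarith
    calc η / (Fintype.card ι + 1) * (v ⬝ᵥ v)
        ≤ η / (Fintype.card ι + 1) * ((Fintype.card ι + 1) * ‖v‖ ^ 2) := by gcongr
      _ = η * ‖v‖ ^ 2 := by field_simp
      _ ≤ _ := h2

end Matrix

/-! ### The Gramian as output energy -/

namespace LTV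

theorem gramian_isSymm {ι o : Type*} [Fintype ι] [Fintype o]
    (Φ : ℝ → ℝ → Matrix ι ι ℝ) (H : ℝ → Matrix o ι ℝ) (t T : ℝ) : (gramian Φ H t T).IsSymm := by
  ext i j
  simp only [gramian, Matrix.transpose_apply, Matrix.of_apply]
  congr 1
  ext s
  have h : ((Φ s t)ᵀ * (H s)ᵀ * H s * Φ s t)ᵀ = (Φ s t)ᵀ * (H s)ᵀ * H s * Φ s t := by
    simp [Matrix.transpose_mul, Matrix.mul_assoc]
  exact congrFun (congrFun h i) j

theorem dotProduct_gramian_mulVec {ι o : Type*} [Fintype ι] [Fintype o]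
    {Φ : ℝ → ℝ → Matrix ι ι ℝ} (H : Matrix o ι ℝ) {t T : ℝ}
    (hΦ : ∀ i j, ContinuousOn (fun s => Φ s t i j) (Set.uIcc t T)) (v : ι → ℝ) :
    v ⬝ᵥ (gramian Φ (fun _ => H) t T *ᵥ v)
      = ∫ s in t..T, (H *ᵥ (Φ s t *ᵥ v)) ⬝ᵥ (H *ᵥ (Φ s t *ᵥ v)) := by
  have hint : ∀ i j, IntervalIntegrable (fun s => ((Φ s t)ᵀ * Hᵀ * H * Φ s t) i j)
      MeasureTheory.volume t T := by
    intro i j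
    apply ContinuousOn.intervalIntegrable
    have hΦ' : ContinuousOn (fun s => Φ s t) (Set.uIcc t T) :=
      continuousOn_pi.2 fun i => continuousOn_pi.2 fun j => hΦ i j
    have : Continuous fun M : Matrix ι ι ℝ => (Mᵀ * Hᵀ * H * M) i j := by fun_prop
    exact this.comp_continuousOn hΦ'
  have hpt : ∀ s, (H *ᵥ (Φ s t *ᵥ v)) ⬝ᵥ (H *ᵥ (Φ s t *ᵥ v))
      = ∑ i, ∑ j, v i * (((Φ s t)ᵀ * Hᵀ * H * Φ s t) i j * v j) := by
    intro s
    have : (H *ᵥ (Φ s t *ᵥ v)) ⬝ᵥ (H *ᵥ (Φ s t *ᵥ v))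
        = v ⬝ᵥ (((Φ s t)ᵀ * Hᵀ * H * Φ s t) *ᵥ v) := by
      rw [Matrix.mulVec_mulVec, Matrix.mul_assoc _ H, ← Matrix.mulVec_mulVec,
        ← Matrix.transpose_mul, Matrix.dotProduct_mulVec v, ← Matrix.vecMul_vecMul, Matrix.vecMul_transpose,
        ← Matrix.dotProduct_mulVec, Matrix.mulVec_mulVec]
    rw [this]
    simp only [dotProduct, Matrix.mulVec, Finset.mul_sum]
  simp_rw [hpt]
  have hij : ∀ i j, IntervalIntegrable (fun s => v i * (((Φ s t)ᵀ * Hᵀ * H * Φ s t) i j * v j))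
      MeasureTheory.volume t T := fun i j => ((hint i j).mul_const (v j)).const_mul (v i)
  rw [intervalIntegral.integral_finsetSum fun i _ => by
    simpa only [Finset.sum_fn] using IntervalIntegrable.sum Finset.univ fun j _ => hij i j]
  simp only [dotProduct, Matrix.mulVec, Finset.mul_sum]
  refine Finset.sum_congr rfl fun i _ => ?_
  rw [intervalIntegral.integral_finsetSum fun j _ => hij i j]
  refine Finset.sum_congr rfl fun j _ => ?_
  rw [intervalIntegral.integral_const_mul, intervalIntegral.integral_mul_const]
  rfl

end LTV

/-! ### Regularity and bounds for the rows `r_i` -/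

namespace QuadraticOutput

theorem Cmat_eq_zero_of_le {n m : ℕ} {A C : Matrix (Fin n) (Fin n) ℝ} (hm : Cmat A C m = 0)
    {i : ℕ} (hi : m ≤ i) : Cmat A C i = 0 := by
  induction i, hi using Nat.le_induction with
  | base => exact hm
  | succ k _ ih => simp [Cmat, ih]

theorem r_succ {n p : ℕ} (A C : Matrix (Fin n) (Fin n) ℝ) (B : Matrix (Fin n) (Fin p) ℝ)
    (u : ℝ → Fin p → ℝ) (i : ℕ) (t : ℝ) :
    r A C B u (i + 1) t = r A C B u i t ᵥ* A + derivWithin (r A C B u i) (Set.Ici 0) t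
      + u t ᵥ* (Bᵀ * Cmat A C i) := rfl

theorem hasDerivWithinAt_vecMul {p n : ℕ} {f : ℝ → Fin p → ℝ} {f' : Fin p → ℝ} {s : Set ℝ} {t : ℝ}
    (hf : HasDerivWithinAt f f' s t) (L : Matrix (Fin p) (Fin n) ℝ) :
    HasDerivWithinAt (fun x => f x ᵥ* L) (f' ᵥ* L) s t :=
  (LinearMap.toContinuousLinearMap (Matrix.vecMulLinear L)).hasFDerivAt.comp_hasDerivWithinAt t hf

variable {n p κ : ℕ} {A C : Matrix (Fin n) (Fin n) ℝ} {B : Matrix (Fin n) (Fin p) ℝ}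
  {u : ℝ → Fin p → ℝ}

theorem BoundedDerivs.hasDerivWithinAt (hu : BoundedDerivs κ u) {i : ℕ} (hi : i < κ) {t : ℝ}
    (ht : 0 ≤ t) : HasDerivWithinAt (iteratedDerivWithin i u (Set.Ici 0))
      (iteratedDerivWithin (i + 1) u (Set.Ici 0) t) (Set.Ici 0) t := by
  rw [iteratedDerivWithin_succ]
  exact (hu.1 i hi t ht).hasDerivWithinAt

theorem BoundedDerivs.hasDerivWithinAt_sum (hu : BoundedDerivs κ u) {i : ℕ} (hi : i ≤ κ)
    {L : ℕ → Matrix (Fin p) (Fin n) ℝ}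
    (hL : ∀ t, 0 ≤ t → r A C B u i t
      = ∑ j ∈ Finset.range i, iteratedDerivWithin j u (Set.Ici 0) t ᵥ* L j) {t : ℝ} (ht : 0 ≤ t) :
    HasDerivWithinAt (r A C B u i)
      (∑ j ∈ Finset.range i, iteratedDerivWithin (j + 1) u (Set.Ici 0) t ᵥ* L j) (Set.Ici 0) t :=
  (HasDerivWithinAt.fun_sum fun j hj => hasDerivWithinAt_vecMul
    (hu.hasDerivWithinAt ((Finset.mem_range.1 hj).trans_le hi) ht) (L j)).congr hL (hL t ht)

/-- `r_i` is a combination, with constant matrix coefficients, of `u` and its derivatives up to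
order `i - 1`. -/
theorem BoundedDerivs.exists_r_eq_sum (hu : BoundedDerivs κ u) (i : ℕ) (hi : i ≤ κ + 1) :
    ∃ L : ℕ → Matrix (Fin p) (Fin n) ℝ, ∀ t, 0 ≤ t → r A C B u i t
      = ∑ j ∈ Finset.range i, iteratedDerivWithin j u (Set.Ici 0) t ᵥ* L j := by
  induction i with
  | zero => exact ⟨0, fun t _ => by simp [r]⟩
  | succ i ih =>
    obtain ⟨L, hL⟩ := ih (by omega)
    -- `r_i A` contributes `L j * A`, differentiation shifts `L (j - 1)` to place `j`, and the input
    -- term enters at `j = 0`. The test `j < i` discards `L i`, about which nothing is known.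
    refine ⟨fun j => (if j < i then L j * A else 0) + (if j = 0 then Bᵀ * Cmat A C i else L (j - 1)),
      fun t ht => ?_⟩
    have hd := (hu.hasDerivWithinAt_sum (by omega) hL ht).derivWithin
      (uniqueDiffOn_Ici (0 : ℝ) t ht)
    rw [r_succ, hd, hL t ht, Matrix.sum_vecMul]
    simp only [Matrix.vecMul_add, Finset.sum_add_distrib, Matrix.vecMul_vecMul]
    rw [Finset.sum_range_succ, Finset.sum_range_succ' _ i, add_assoc]
    have : ∑ x ∈ Finset.range i, iteratedDerivWithin x u (Set.Ici 0) t ᵥ* (if x < i then L x * A else 0)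
        = ∑ x ∈ Finset.range i, iteratedDerivWithin x u (Set.Ici 0) t ᵥ* (L x * A) :=
      Finset.sum_congr rfl fun x hx => by rw [if_pos (Finset.mem_range.1 hx)]
    simp [this]

theorem BoundedDerivs.hasDerivWithinAt_r (hu : BoundedDerivs κ u) {i : ℕ} (hi : i ≤ κ) {t : ℝ}
    (ht : 0 ≤ t) :
    HasDerivWithinAt (r A C B u i) (derivWithin (r A C B u i) (Set.Ici 0) t) (Set.Ici 0) t := by
  obtain ⟨L, hL⟩ := hu.exists_r_eq_sum (A := A) (C := C) (B := B) i (by omega)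
  exact (hu.hasDerivWithinAt_sum hi hL ht).differentiableWithinAt.hasDerivWithinAt

/-- Order `κ + 1` is included: `r_{κ+1}` involves `u` only up to order `κ`, and interpolation needs
this one further bound. -/
theorem BoundedDerivs.exists_norm_r_le (hu : BoundedDerivs κ u) :
    ∃ R : ℝ, 0 ≤ R ∧ ∀ i ≤ κ + 1, ∀ t, 0 ≤ t → ‖r A C B u i t‖ ≤ R := by
  have h1 : ∀ i ∈ Finset.range (κ + 2), ∃ R : ℝ, 0 ≤ R ∧ ∀ t, 0 ≤ t → ‖r A C B u i t‖ ≤ R := by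
    intro i hi
    have hi' : i < κ + 2 := Finset.mem_range.1 hi
    obtain ⟨L, hL⟩ := hu.exists_r_eq_sum (A := A) (C := C) (B := B) i (by omega)
    choose! M hM using hu.2
    refine ⟨∑ j ∈ Finset.range i,
      ‖LinearMap.toContinuousLinearMap (Matrix.vecMulLinear (L j))‖ * |M j|,
      Finset.sum_nonneg fun j _ => by positivity, fun t ht => ?_⟩
    rw [hL t ht]
    refine (norm_sum_le _ _).trans (Finset.sum_le_sum fun j hj => ?_)
    have hj' := Finset.mem_range.1 hj
    refine ((LinearMap.toContinuousLinearMap (Matrix.vecMulLinear (L j))).le_opNorm _).trans ?_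
    gcongr
    exact (hM j (by omega) t ht).trans (le_abs_self _)
  choose! R hR0 hR using h1
  refine ⟨∑ i ∈ Finset.range (κ + 2), R i, Finset.sum_nonneg hR0, fun i hi t ht => ?_⟩
  have hi' : i ∈ Finset.range (κ + 2) := Finset.mem_range.2 (by omega)
  exact (hR i hi' t ht).trans (Finset.single_le_sum hR0 hi')

end QuadraticOutput

/-! ### Output derivatives and recovery of the state -/

namespace QuadraticOutput

variable {n p m κ : ℕ} {A C : Matrix (Fin n) (Fin n) ℝ} {B : Matrix (Fin n) (Fin p) ℝ}
  {u : ℝ → Fin p → ℝ}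

/-- The `i`-th derivative `z_i + r_i x` of the output along a solution of the augmented system that
is in state `w = (z, x)` at time `t`, where `z_i = 0` for `i ≥ m`. -/
noncomputable def outputDeriv (A C : Matrix (Fin n) (Fin n) ℝ) (B : Matrix (Fin n) (Fin p) ℝ)
    (u : ℝ → Fin p → ℝ) (i : ℕ) (t : ℝ) (w : Fin m ⊕ Fin n → ℝ) : ℝ :=
  (if h : i < m then w (Sum.inl ⟨i, h⟩) else 0) + r A C B u i t ⬝ᵥ fun j => w (Sum.inr j)

theorem augC_mulVec (w : Fin m ⊕ Fin n → ℝ) (t : ℝ) (k : Fin 1) :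
    (augC m n *ᵥ w) k = outputDeriv A C B u 0 t w := by
  simp only [augC, outputDeriv, Matrix.mulVec, dotProduct, Matrix.of_apply, Fintype.sum_sum_type,
    Sum.elim_inl, Sum.elim_inr, r]
  simp only [ite_mul, one_mul, zero_mul, Finset.sum_const_zero, Pi.zero_apply, add_zero]
  split_ifs with h
  · rw [Finset.sum_eq_single ⟨0, h⟩]
    · simp
    · intro b _ hb
      rw [if_neg fun h0 => hb (Fin.ext h0)]
    · simp
  · exact Finset.sum_eq_zero fun x _ => absurd (x.pos) h

theorem shift_mulVec (z : Fin m → ℝ) (i : Fin m) :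
    (shift m *ᵥ z) i = if h : (i : ℕ) + 1 < m then z ⟨i + 1, h⟩ else 0 := by
  simp only [shift, Matrix.mulVec, dotProduct, Matrix.of_apply, ite_mul, one_mul, zero_mul]
  split_ifs with h
  · rw [Finset.sum_eq_single ⟨i + 1, h⟩]
    · simp
    · intro b _ hb
      rw [if_neg fun h0 => hb (Fin.ext h0)]
    · simp
  · exact Finset.sum_eq_zero fun x _ => if_neg fun h0 => h (by omega)

/-- `ż_i = z_{i+1} + uᵀBᵀC_i x` and `(r_i x)˙ = (ṙ_i + r_i A) x`; the recursion for `r` collects the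
coefficients of `x` into `r_{i+1}`. -/
theorem BoundedDerivs.hasDerivWithinAt_outputDeriv (hu : BoundedDerivs κ u)
    (hm : Cmat A C m = 0) {w : ℝ → Fin m ⊕ Fin n → ℝ} {s : Set ℝ} (hs : s ⊆ Set.Ici 0)
    (hw : ∀ t ∈ s, HasDerivWithinAt w (augA A C B m u t *ᵥ w t) s t) {i : ℕ} (hi : i ≤ κ)
    {t : ℝ} (ht : t ∈ s) :
    HasDerivWithinAt (fun t => outputDeriv A C B u i t (w t))
      (outputDeriv A C B u (i + 1) t (w t)) s t := by
  have hw' := hasDerivWithinAt_pi.1 (hw t ht)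
  have hblock : augA A C B m u t *ᵥ w t
      = Sum.elim (shift m *ᵥ (w t ∘ Sum.inl) + inputBlock A C B m u t *ᵥ (w t ∘ Sum.inr))
        (A *ᵥ (w t ∘ Sum.inr)) := by
    rw [augA, Matrix.fromBlocks_mulVec]
    simp
  have hz : HasDerivWithinAt (fun t => if h : i < m then w t (Sum.inl ⟨i, h⟩) else 0)
      ((if h : i + 1 < m then w t (Sum.inl ⟨i + 1, h⟩) else 0)
        + (u t ᵥ* (Bᵀ * Cmat A C i)) ⬝ᵥ fun j => w t (Sum.inr j)) s t := by
    by_cases h : i < m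
    · have := hw' (Sum.inl ⟨i, h⟩)
      rw [hblock, Sum.elim_inl, Pi.add_apply, shift_mulVec] at this
      simp only [h, dite_true]
      exact this
    · have h' : ¬ i + 1 < m := by omega
      simpa only [h, h', dite_false, Cmat_eq_zero_of_le hm (not_lt.1 h), Matrix.mul_zero,
        Matrix.vecMul_zero, zero_dotProduct, add_zero] using hasDerivWithinAt_const t s (0 : ℝ)
  have hr := hasDerivWithinAt_pi.1
    ((hu.hasDerivWithinAt_r (A := A) (C := C) (B := B) hi (hs ht)).mono hs)
  have hrx : HasDerivWithinAt (fun t => r A C B u i t ⬝ᵥ fun j => w t (Sum.inr j))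
      (derivWithin (r A C B u i) (Set.Ici 0) t ⬝ᵥ (fun j => w t (Sum.inr j))
        + r A C B u i t ⬝ᵥ (A *ᵥ fun j => w t (Sum.inr j))) s t := by
    simp only [dotProduct, ← Finset.sum_add_distrib]
    refine HasDerivWithinAt.fun_sum fun j _ => ?_
    have := hw' (Sum.inr j)
    rw [hblock, Sum.elim_inr] at this
    exact (hr j).fun_mul this
  refine (hz.fun_add hrx).congr_deriv ?_
  simp only [outputDeriv]
  rw [r_succ, add_dotProduct, add_dotProduct, Matrix.dotProduct_mulVec]
  ring

theorem BoundedDerivs.continuousOn_inputBlock (hu : BoundedDerivs κ u) (hκ : m ≤ κ) (i : Fin m)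
    (j : Fin n) : ContinuousOn (fun t => inputBlock A C B m u t i j) (Set.Ici 0) := by
  have hcont : ContinuousOn u (Set.Ici 0) := by
    simpa using (hu.1 0 (i.pos.trans_le hκ)).continuousOn
  have : Continuous fun v : Fin p → ℝ => (v ᵥ* (Bᵀ * Cmat A C i)) j := by fun_prop
  exact this.comp_continuousOn hcont

theorem BoundedDerivs.exists_norm_augA_mulVec_le (hu : BoundedDerivs κ u)
    (A C : Matrix (Fin n) (Fin n) ℝ) (B : Matrix (Fin n) (Fin p) ℝ) (m : ℕ) :
    ∃ K : ℝ, 0 ≤ K ∧ ∀ t, 0 ≤ t → ∀ w, ‖augA A C B m u t *ᵥ w‖ ≤ K * ‖w‖ := by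
  obtain ⟨M, hM⟩ := hu.2 0 (Nat.zero_le _)
  simp only [iteratedDerivWithin_zero] at hM
  -- The matrix depends on time only through the value of `u`, which stays in a compact ball.
  have hcont : ∀ a b, Continuous fun v : Fin p → ℝ => |augA A C B m (fun _ => v) 0 a b| := by
    rintro (a | a) (b | b)
    · simpa [augA] using continuous_const
    · have : Continuous fun v : Fin p → ℝ => (v ᵥ* (Bᵀ * Cmat A C a)) b := by fun_prop
      exact this.abs
    · simpa [augA] using continuous_const
    · simpa [augA] using continuous_const
  have hb : ∀ a b, ∃ K : ℝ, 0 ≤ K ∧ ∀ t, 0 ≤ t → |augA A C B m u t a b| ≤ K := by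
    intro a b
    obtain ⟨K, hK⟩ := (isCompact_closedBall (0 : Fin p → ℝ) M).bddAbove_image
      (hcont a b).continuousOn
    refine ⟨max K 0, le_max_right _ _, fun t ht => le_max_of_le_left ?_⟩
    exact hK ⟨u t, by simpa using hM t ht, rfl⟩
  choose K hK0 hK using hb
  have hK' : 0 ≤ ∑ a, ∑ b, K a b :=
    Finset.sum_nonneg fun a _ => Finset.sum_nonneg fun b _ => hK0 a b
  refine ⟨_, by positivity, fun t ht w => norm_mulVec_le_of_abs_le hK' (fun a b => ?_) w⟩
  refine (hK a b t ht).trans ((Finset.single_le_sum (fun b _ => hK0 a b) (Finset.mem_univ b)).trans ?_)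
  exact Finset.single_le_sum (f := fun a => ∑ b, K a b)
    (fun a _ => Finset.sum_nonneg fun b _ => hK0 a b) (Finset.mem_univ a)

/-- If all the `r_i x` with `m ≤ i ≤ κ` are small, then so is `x`, provided that
`det (∑ r_iᵀ r_i)` is bounded away from zero. -/
theorem exists_norm_le_of_le_abs_det (n : ℕ) (m κ : ℕ) {R d : ℝ} (hR : 0 ≤ R) (hd : 0 < d) :
    ∃ K : ℝ, 0 ≤ K ∧ ∀ (ρ : ℕ → Fin n → ℝ) (x : Fin n → ℝ) (ε : ℝ), (∀ i ≤ κ, ‖ρ i‖ ≤ R) →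
      d ≤ |(∑ i ∈ Finset.Icc m κ, Matrix.vecMulVec (ρ i) (ρ i)).det| →
      (∀ i, m ≤ i → i ≤ κ → |ρ i ⬝ᵥ x| ≤ ε) → ‖x‖ ≤ K * ε := by
  obtain ⟨K, hK0, hK⟩ := exists_abs_adjugate_le (Fin n) ((Finset.Icc m κ).card * R ^ 2)
  refine ⟨Fintype.card (Fin n) * K * ((Finset.Icc m κ).card * R) / d, by positivity,
    fun ρ x ε hρ hdet hε => ?_⟩
  set Q := ∑ i ∈ Finset.Icc m κ, Matrix.vecMulVec (ρ i) (ρ i) with hQ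
  have hQb : ∀ a b, |Q a b| ≤ (Finset.Icc m κ).card * R ^ 2 := by
    intro a b
    rw [hQ, Matrix.sum_apply, ← nsmul_eq_mul]
    refine (Finset.abs_sum_le_sum_abs _ _).trans (Finset.sum_le_card_nsmul _ _ _ fun i hi => ?_)
    have hi' := hρ i (Finset.mem_Icc.1 hi).2
    rw [Matrix.vecMulVec_apply, abs_mul, sq]
    exact mul_le_mul ((norm_le_pi_norm (ρ i) a).trans hi') ((norm_le_pi_norm (ρ i) b).trans hi')
      (abs_nonneg _) hR
  have hQx : ‖Q *ᵥ x‖ ≤ (Finset.Icc m κ).card * R * ε := by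
    rw [hQ, Matrix.sum_vecMulVec_self_mulVec, mul_assoc, ← nsmul_eq_mul]
    refine (norm_sum_le _ _).trans (Finset.sum_le_card_nsmul _ _ _ fun i hi => ?_)
    obtain ⟨h1, h2⟩ := Finset.mem_Icc.1 hi
    rw [norm_smul, mul_comm R]
    have := hε i h1 h2
    exact mul_le_mul this (hρ i h2) (norm_nonneg _) ((abs_nonneg _).trans this)
  have hmain := Matrix.abs_det_mul_norm_le hK0 (hK Q hQb) x
  rw [div_mul_eq_mul_div, le_div_iff₀ hd]
  calc ‖x‖ * d ≤ |Q.det| * ‖x‖ := by rw [mul_comm]; gcongr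
    _ ≤ Fintype.card (Fin n) * K * ‖Q *ᵥ x‖ := hmain
    _ ≤ Fintype.card (Fin n) * K * ((Finset.Icc m κ).card * R * ε) := by gcongr
    _ = _ := by ring

theorem exists_le_abs_of_le_integral {f : ℝ → ℝ} {δ μ t : ℝ} (hδ : 0 < δ) (hμ : 0 < μ)
    (h : μ ≤ ∫ s in t..(t + δ), f s) : ∃ s ∈ Set.Icc t (t + δ), μ / (2 * δ) ≤ |f s| := by
  by_contra! hc
  have := intervalIntegral.norm_integral_le_of_norm_le_const (f := f) (a := t) (b := t + δ)
    (C := μ / (2 * δ)) fun s hs => by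
      rw [Set.uIoc_of_le (by linarith)] at hs
      exact (hc s ⟨hs.1.le, hs.2⟩).le
  have h2 : μ / (2 * δ) * |t + δ - t| = μ / 2 := by
    rw [add_sub_cancel_left, abs_of_pos hδ]
    field_simp
  rw [h2, Real.norm_eq_abs] at this
  linarith [le_abs_self (∫ s in t..(t + δ), f s)]

theorem abs_outputDeriv_le {R : ℝ} {i : ℕ} {t : ℝ} (hR : ‖r A C B u i t‖ ≤ R)
    (w : Fin m ⊕ Fin n → ℝ) : |outputDeriv A C B u i t w| ≤ (1 + n * R) * ‖w‖ := by
  have h1 : |if h : i < m then w (Sum.inl ⟨i, h⟩) else 0| ≤ ‖w‖ := by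
    split_ifs
    · exact norm_le_pi_norm w _
    · simp
  have h2 := Matrix.abs_dotProduct_le_card_mul (r A C B u i t) fun j => w (Sum.inr j)
  have h3 : ‖fun j => w (Sum.inr j)‖ ≤ ‖w‖ :=
    (pi_norm_le_iff_of_nonneg (norm_nonneg _)).2 fun j => norm_le_pi_norm w _
  rw [Fintype.card_fin] at h2
  have h4 : (n : ℝ) * ‖r A C B u i t‖ * ‖fun j => w (Sum.inr j)‖ ≤ n * R * ‖w‖ :=
    mul_le_mul (mul_le_mul_of_nonneg_left hR n.cast_nonneg) h3 (norm_nonneg _)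
      (mul_nonneg n.cast_nonneg ((norm_nonneg _).trans hR))
  have := abs_add_le (if h : i < m then w (Sum.inl ⟨i, h⟩) else 0)
    (r A C B u i t ⬝ᵥ fun j => w (Sum.inr j))
  rw [outputDeriv]
  linarith

/-- The state is recovered from the output derivatives of order up to `κ` at a time where
`det (∑ r_iᵀ r_i)` is bounded away from zero. -/
theorem exists_norm_le_of_abs_outputDeriv_le (A C : Matrix (Fin n) (Fin n) ℝ)
    (B : Matrix (Fin n) (Fin p) ℝ) (u : ℝ → Fin p → ℝ) (hκ : m ≤ κ) {R d : ℝ} (hR : 0 ≤ R)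
    (hd : 0 < d) :
    ∃ K : ℝ, 0 ≤ K ∧ ∀ (t : ℝ) (w : Fin m ⊕ Fin n → ℝ) (ε : ℝ), 0 ≤ ε →
      (∀ i ≤ κ, ‖r A C B u i t‖ ≤ R) →
      d ≤ |(∑ i ∈ Finset.Icc m κ, Matrix.vecMulVec (r A C B u i t) (r A C B u i t)).det| →
      (∀ i ≤ κ, |outputDeriv A C B u i t w| ≤ ε) → ‖w‖ ≤ K * ε := by
  obtain ⟨K, hK0, hK⟩ := exists_norm_le_of_le_abs_det n m κ hR hd
  refine ⟨1 + K + n * R * K, by positivity, fun t w ε hε0 hr hdet hε => ?_⟩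
  set x : Fin n → ℝ := fun j => w (Sum.inr j) with hx
  -- For orders `i ≥ m` the output derivative is `r_i x` alone.
  have hxε : ‖x‖ ≤ K * ε := hK (fun i => r A C B u i t) x ε hr hdet fun i hi hi' => by
    simpa [outputDeriv, not_lt.2 hi] using hε i hi'
  refine (pi_norm_le_iff_of_nonneg (by positivity)).2 ?_
  rintro (i | j)
  · have h1 := hε i (i.isLt.le.trans hκ)
    simp only [outputDeriv, i.isLt, dite_true, Fin.eta] at h1
    have h2 := Matrix.abs_dotProduct_le_card_mul (r A C B u i t) x
    rw [Fintype.card_fin] at h2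
    have h3 : (n : ℝ) * ‖r A C B u i t‖ * ‖x‖ ≤ n * R * (K * ε) := by
      have := hr i (i.isLt.le.trans hκ)
      gcongr
    have h4 : 0 ≤ K * ε := by positivity
    rw [Real.norm_eq_abs]
    rw [abs_le] at *
    constructor <;> linarith [h1.1, h1.2, h2.1, h2.2]
  · have h1 : ‖w (Sum.inr j)‖ ≤ ‖x‖ := norm_le_pi_norm x j
    have h4 : 0 ≤ n * R * K * ε := by positivity
    linarith

end QuadraticOutput

theorem proposition2 {n p m κ : ℕ}
    (A C : Matrix (Fin n) (Fin n) ℝ) (B : Matrix (Fin n) (Fin p) ℝ)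
    (hC : C.IsSymm)
    (hm : QuadraticOutput.Cmat A C m = 0)
    (u : ℝ → Fin p → ℝ)
    (hκ : m ≤ κ) (hu : QuadraticOutput.BoundedDerivs κ u)
    (δ μ : ℝ) (hδ : 0 < δ) (hμ : 0 < μ)
    (hPE : ∀ t : ℝ, 0 ≤ t →
      μ ≤ ∫ s in t..(t + δ),
        (∑ i ∈ Finset.Icc m κ,
          Matrix.vecMulVec (QuadraticOutput.r A C B u i s)
            (QuadraticOutput.r A C B u i s)).det) :
    LTV.UniformlyObservable (QuadraticOutput.augA A C B m u)
      (fun _ => QuadraticOutput.augC m n) := by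
  obtain ⟨Φ, hΦ⟩ := exists_isTransitionMatrix_fromBlocks (QuadraticOutput.shift m) A
    (QuadraticOutput.inputBlock A C B m u) (hu.continuousOn_inputBlock hκ)
  obtain ⟨K, hK0, hK⟩ := hu.exists_norm_augA_mulVec_le A C B m
  obtain ⟨R, hR0, hR⟩ := hu.exists_norm_r_le (A := A) (C := C) (B := B)
  obtain ⟨K', hK'0, hK'⟩ := QuadraticOutput.exists_norm_le_of_abs_outputDeriv_le (m := m) A C B u hκ hR0
    (show 0 < μ / (2 * δ) by positivity)
  -- Bounds the growth over one window, in either time direction.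
  set G : ℝ := Real.exp (K * δ) with hG
  have hG0 : 0 < G := Real.exp_pos _
  -- The tolerance is chosen so that recovery (factor `K'`) and backward Gronwall (factor `G`) leave
  -- at most `1 / 2`.
  obtain ⟨η, hη, H⟩ := exists_abs_le_of_integral_sq_le_of_hasDerivWithinAt hδ
    (show 0 ≤ (1 + n * R) * G by positivity) κ (1 / (2 * (K' + 1) * G)) (by positivity)
  refine ⟨Φ, hΦ, δ, hδ, η / (Fintype.card (Fin m ⊕ Fin n) + 1), by positivity, fun t ht => ?_⟩
  refine Matrix.posSemidef_sub_smul_one_of_le (LTV.gramian_isSymm _ _ _ _) hη.le fun v hv => ?_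
  have hle : t ≤ t + δ := by linarith
  have hsub : Set.Icc t (t + δ) ⊆ Set.Ici 0 := fun s hs => ht.trans hs.1
  rw [LTV.dotProduct_gramian_mulVec _ fun i j s hs => by
    rw [Set.uIcc_of_le hle] at hs ⊢
    exact ((hΦ t ht).2 s (hsub hs) i j).continuousWithinAt.mono hsub]
  simp only [dotProduct, Finset.univ_unique, Finset.sum_singleton, ← sq]
  simp_rw [fun s => QuadraticOutput.augC_mulVec (A := A) (C := C) (B := B) (u := u)
    (Φ s t *ᵥ v) s default]
  set w : ℝ → Fin m ⊕ Fin n → ℝ := fun s => Φ s t *ᵥ v with hw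
  have hwt : w t = v := by simp [hw, (hΦ t ht).1]
  have hwd : ∀ s ∈ Set.Icc t (t + δ), HasDerivWithinAt w
      (QuadraticOutput.augA A C B m u s *ᵥ w s) (Set.Icc t (t + δ)) s := by
    intro s hs
    rw [hw, hasDerivWithinAt_pi]
    intro i
    simp only [Matrix.mulVec_mulVec]
    exact HasDerivWithinAt.fun_sum (u := Finset.univ) fun j _ =>
      (((hΦ t ht).2 s (hsub hs) i j).mono hsub).mul_const (v j)
  have hwb : ∀ s ∈ Set.Icc t (t + δ), ‖w s‖ ≤ G := by
    intro s hs
    have := norm_le_exp_mul_of_hasDerivWithinAt hwd (fun s hs => hK s (hsub hs) (w s)) s hs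
    rw [hwt, hv, one_mul] at this
    exact this.trans (Real.exp_le_exp.2 (by gcongr; linarith [hs.2]))
  by_contra! hlt
  obtain ⟨s, hs, hdet⟩ := QuadraticOutput.exists_le_abs_of_le_integral hδ hμ (hPE t ht)
  have hsmall := H t (fun i s => QuadraticOutput.outputDeriv A C B u i s (w s))
    (fun i hi s hs => hu.hasDerivWithinAt_outputDeriv hm hsub hwd hi hs)
    (fun i hi s hs => (QuadraticOutput.abs_outputDeriv_le (hR i hi s (hsub hs)) (w s)).trans
      (by have := hwb s hs; gcongr)) hlt.le
  have hws := hK' s (w s) _ (by positivity) (fun i hi => hR i (by omega) s (hsub hs)) hdet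
    (fun i hi => hsmall i hi s hs)
  have hIcc : Set.Icc t s ⊆ Set.Icc t (t + δ) := Set.Icc_subset_Icc_right hs.2
  have hback := norm_left_le_exp_mul_of_hasDerivWithinAt
    (fun x hx => (hwd x (hIcc hx)).mono hIcc)
    (fun x hx => hK x (hsub (hIcc hx)) (w x)) hs.1
  rw [hwt, hv] at hback
  have : (1 : ℝ) ≤ 1 / 2 := by
    calc (1 : ℝ) ≤ ‖w s‖ * Real.exp (K * (s - t)) := hback
      _ ≤ K' * (1 / (2 * (K' + 1) * G)) * G := by
        gcongr
        exact Real.exp_le_exp.2 (by gcongr; linarith [hs.2])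
      _ = (K' / (K' + 1)) / 2 := by field_simp
      _ ≤ 1 / 2 := by
        gcongr
        exact (div_le_one (by positivity)).2 (by linarith)
  norm_num at this
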